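/- Let $1\le l<k$ be integers, let $A,B_1,\dots,B_k$ be finite sets in a commutative group $G$ (written additively), and put $m=|A|$, $K=\{1,\dots,k\}$. For $I\subseteq K$ let $B_I=\sum_{i\in I}B_i$ be the sumset and, when $m>0$, let $\alpha_I=|A+B_I|/m$. Put $$\beta=\Bigl(\prod_{L\subseteq K,\ |L|=l}\alpha_L\Bigr)^{(l-1)!\,(k-l)!/(k-1)!}.$$ (a) For every integer $a$ with $1\le a\le m$ there exists $X\subseteq A$ with $|X|\ge a$ such that $$|X+B_K|\le\beta\, m^{k/l}\Bigl(\sum_{j=0}^{a-1}(m-j)^{-k/l}+(|X|-a)(m-a+1)^{-k/l}\Bigr).$$ (b) For every real number $t$ with $0\le t<m$ there exists $X\subseteq A$ with $|X|>t$ such that $$|X+B_K|\le\beta\, m^{k/l}\Bigl(\frac{l}{k-l}\bigl((m-t)^{1-k/l}-m^{1-k/l}\bigr)+(|X|-t)(m-t)^{-k/l}\Bigr).$$ -/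

import Mathlib

open scoped Pointwise Nat

namespace DifferentSummands

/-- The sumset `B_I = ∑_{i ∈ I} B_i` of a subfamily of finite sets (it is `{0}` for `I = ∅`). -/
def sumset {G : Type*} [AddCommGroup G] [DecidableEq G] {k : ℕ}
    (B : Fin k → Finset G) (I : Finset (Fin k)) : Finset G :=
  ∑ i ∈ I, B i

/-- The ratio `α_I = |A + B_I| / |A|`. -/
noncomputable def alpha {G : Type*} [AddCommGroup G] [DecidableEq G] {k : ℕ}
    (A : Finset G) (B : Fin k → Finset G) (I : Finset (Fin k)) : ℝ :=
  ((A + sumset B I).card : ℝ) / (A.card : ℝ)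

/-- The number `β = (∏_{L ⊆ K, |L| = l} α_L) ^ ((l-1)! (k-l)! / (k-1)!)`,
where `K` is the full index set; used for `1 ≤ l < k` only. -/
noncomputable def beta {G : Type*} [AddCommGroup G] [DecidableEq G] {k : ℕ}
    (l : ℕ) (A : Finset G) (B : Fin k → Finset G) : ℝ :=
  (∏ L ∈ (Finset.univ : Finset (Fin k)).powersetCard l, alpha A B L) ^
    ((((l - 1)! : ℕ) : ℝ) * (((k - l)! : ℕ) : ℝ) / (((k - 1)! : ℕ) : ℝ))

end DifferentSummands

/-! The core is a sharp bound for some nonempty X: |X + B_K| ≤ β|X| (`exists_nonempty_card_add_le`).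
It is applied repeatedly to the part A' of A not yet used. The ratios of A' exceed those of A by a
factor of at most m/|A'|, so β grows by at most (m/|A'|)^(k/l). The union of the pieces gives (a) by
`exists_large_card_add_le_sum`, and comparing the sum with an integral gives (b).

The core is a weighted Plünnecke argument. The layered graph has vertices (I, x) with x ∈ A + B_I,
edges that add an element of some B_p with p ∉ I, and weights ∏_{i∈I} ω_i. Commutativity of G allows
a minimal cut to be pushed into the bottom and top layers (`exists_separates_subset_bot_top`).
Comparison with the cut formed by layer l yields `card_le_sum_weight_of_magnification`.

For l = k - 1 a suitable ω gives the bound up to a constant, and induction on k - l extends this to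
every l (`exists_const_card_add_le`). The constant does not depend on the group, and the other
quantities are multiplicative under direct products, so high powers of G remove it. -/

namespace DifferentSummands

/-! ### Minimal cuts in weighted commutative graphs -/

/-- The vertices reachable from `bot` by a path that avoids `S`. -/
inductive Up {V : Type*} (E : V → V → Prop) (bot : V → Prop) (S : Finset V) : V → Prop
  | base (v : V) : bot v → v ∉ S → Up E bot S v
  | step (u v : V) : Up E bot S u → E u v → v ∉ S → Up E bot S v

/-- The vertex set `S` meets every path from `bot` to `top`. -/
def Separates {V : Type*} (E : V → V → Prop) (bot top : V → Prop) (S : Finset V) : Prop :=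
  ∀ v, Up E bot S v → Up (fun x y => E y x) top S v → False

section Cut

variable {V : Type*} {E : V → V → Prop} {bot top : V → Prop} {S : Finset V}

theorem Up.not_mem {v : V} (h : Up E bot S v) : v ∉ S := by
  cases h <;> assumption

theorem Separates.symm (h : Separates E bot top S) :
    Separates (fun x y => E y x) top bot S := fun v h1 h2 => h v h2 h1

/-- Reachability of v propagates along the path from v to the top until it arrives at a top vertex.
-/
theorem separates_of_forall_top (h : ∀ v, top v → ¬ Up E bot S v) : Separates E bot top S := by
  intro v hv hd
  induction hd with
  | base v ht hS => exact h v ht hv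
  | step w v hw hE _ ih => exact ih (Up.step v w hv hE hw.not_mem)

theorem Separates.mem_of_adj_adj (h : Separates E bot top S) {u v w : V} (hu : Up E bot S u)
    (huv : E u v) (hvw : E v w) (hw : Up (fun x y => E y x) top S w) : v ∈ S := by
  by_contra hv
  exact h v (Up.step u v hu huv hv) (Up.step w v hw hvw hv)

open Classical in
/-- Part of a separating set may be replaced by the reachable vertices that precede it. -/
theorem Separates.replace (h : Separates E bot top S) {T N : Finset V}
    (hT : ∀ v ∈ T, ¬ bot v) (hN : ∀ u, Up E bot S u → (∃ v ∈ T, E u v) → u ∈ N) :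
    Separates E bot top (S \ T ∪ N) := by
  -- A path avoiding the new set could enter S only in T. That vertex is not a bottom one, and its
  -- predecessor on the path would lie in `N`.
  have key : ∀ v, Up E bot (S \ T ∪ N) v → Up E bot S v := by
    intro v hv
    induction hv with
    | base v hb hv =>
      refine Up.base v hb fun hS => hv ?_
      have : v ∉ T := fun h => hT v h hb
      simp [hS, this]
    | step u v hu hE hv ih =>
      refine Up.step u v ih hE fun hS => ?_
      by_cases hvT : v ∈ T
      · exact hu.not_mem (Finset.mem_union_right _ (hN u ih ⟨v, hvT, hE⟩))
      · exact hv (by simp [hS, hvT])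
  refine separates_of_forall_top fun v ht hv => h v (key v hv) (Up.base v ht ?_)
  exact (key v hv).not_mem

open Classical in
/-- If every subset of `Q` expands to a neighbourhood of at least its weight and `f` dominates `g`
along adjacency, then the weighted sum of `f` over `P` is at least that of `g` over `Q`. -/
theorem sum_mul_le_of_expanding {w f g : V → ℝ} {R : V → V → Prop} {P Q : Finset V}
    (hw : ∀ v, 0 ≤ w v)
    (hexp : ∀ T ⊆ Q, ∑ v ∈ T, w v ≤ ∑ u ∈ P with ∃ v ∈ T, R u v, w u)
    (hfg : ∀ u ∈ P, ∀ v ∈ Q, R u v → g v ≤ f u) (hf : ∀ u ∈ P, 0 ≤ f u) :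
    ∑ v ∈ Q, w v * g v ≤ ∑ u ∈ P, w u * f u := by
  -- Summation over level sets of `g`: vertices enter in decreasing order of `g`, and expansion pays
  -- for lowering the threshold from `g a` to `c`.
  have key : ∀ T : Finset V, T ⊆ Q → ∀ c : ℝ, (∀ v ∈ T, c ≤ g v) →
      ∑ v ∈ T, w v * (g v - c) ≤ ∑ u ∈ P with ∃ v ∈ T, R u v, w u * (f u - c) := by
    intro T
    induction T using Finset.induction_on_min_value g with
    | empty => intros; simp
    | insert a s has hmin ih =>
      intro hsub c hc
      have hs : s ⊆ Q := fun x hx => hsub (Finset.mem_insert_of_mem hx)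
      have h1 := ih hs (g a) hmin
      have h2 := hexp _ hsub
      have hca : c ≤ g a := hc a (Finset.mem_insert_self _ _)
      have h3 : ∑ u ∈ P with ∃ v ∈ s, R u v, w u * (f u - g a) ≤
          ∑ u ∈ P with ∃ v ∈ insert a s, R u v, w u * (f u - g a) := by
        refine Finset.sum_le_sum_of_subset_of_nonneg ?_ ?_
        · intro u hu
          simp only [Finset.mem_filter] at hu ⊢
          obtain ⟨hu, v, hv, hr⟩ := hu
          exact ⟨hu, v, Finset.mem_insert_of_mem hv, hr⟩
        · intro u hu _
          simp only [Finset.mem_filter] at hu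
          obtain ⟨hu, v, hv, hr⟩ := hu
          have : g a ≤ g v := by
            rcases Finset.mem_insert.1 hv with rfl | hv
            · exact le_rfl
            · exact hmin v hv
          exact mul_nonneg (hw u) (by linarith [hfg u hu v (hsub hv) hr])
      have h4 : ∑ v ∈ insert a s, w v * (g v - c) =
          ∑ v ∈ s, w v * (g v - g a) + (g a - c) * ∑ v ∈ insert a s, w v := by
        have : ∑ v ∈ s, w v * (g v - g a) = ∑ v ∈ insert a s, w v * (g v - g a) := by
          rw [Finset.sum_insert has]; ring
        rw [this, Finset.mul_sum, ← Finset.sum_add_distrib]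
        exact Finset.sum_congr rfl fun _ _ => by ring
      have h5 : ∑ u ∈ P with ∃ v ∈ insert a s, R u v, w u * (f u - c) =
          ∑ u ∈ P with ∃ v ∈ insert a s, R u v, w u * (f u - g a) +
            (g a - c) * ∑ u ∈ P with ∃ v ∈ insert a s, R u v, w u := by
        rw [Finset.mul_sum, ← Finset.sum_add_distrib]
        exact Finset.sum_congr rfl fun _ _ => by ring
      have h6 := mul_le_mul_of_nonneg_left h2 (sub_nonneg.2 hca)
      rw [h4, h5]
      linarith
  calc ∑ v ∈ Q, w v * g v ≤ ∑ v ∈ Q with 0 ≤ g v, w v * g v := by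
        rw [Finset.sum_filter]
        refine Finset.sum_le_sum fun v _ => ?_
        split_ifs with h
        · exact le_rfl
        · exact mul_nonpos_of_nonneg_of_nonpos (hw v) (not_le.1 h).le
    _ ≤ ∑ u ∈ P with ∃ v ∈ Q.filter (fun v => 0 ≤ g v), R u v, w u * f u := by
        simpa using key (Q.filter fun v => 0 ≤ g v) (Finset.filter_subset _ _) 0
          (fun v hv => (Finset.mem_filter.1 hv).2)
    _ ≤ ∑ u ∈ P, w u * f u :=
        Finset.sum_le_sum_of_subset_of_nonneg (Finset.filter_subset _ _)
          fun u hu _ => mul_nonneg (hw u) (hf u hu)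

-- Otherwise exchanging `T` for its reachable predecessors, by `Separates.replace`, would give a
-- lighter separating set.
open Classical in
theorem Separates.weight_le_of_minimal {w : V → ℝ} {𝒱 T P : Finset V}
    (hS𝒱 : S ⊆ 𝒱) (h : Separates E bot top S)
    (hmin : ∀ S' ⊆ 𝒱, Separates E bot top S' → ∑ v ∈ S, w v ≤ ∑ v ∈ S', w v)
    (hw : ∀ v, 0 ≤ w v) (hTS : T ⊆ S) (hT : ∀ v ∈ T, ¬ bot v) (hP𝒱 : P ⊆ 𝒱)
    (hP : ∀ u, Up E bot S u → (∃ v ∈ T, E u v) → u ∈ P) :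
    ∑ v ∈ T, w v ≤ ∑ u ∈ P with ∃ v ∈ T, E u v, w u := by
  have h1 := hmin (S \ T ∪ P.filter fun u => ∃ v ∈ T, E u v)
    (Finset.union_subset (Finset.sdiff_subset.trans hS𝒱) ((Finset.filter_subset _ _).trans hP𝒱))
    (h.replace hT fun u hu hv => Finset.mem_filter.2 ⟨hP u hu hv, hv⟩)
  have h2 := Finset.sum_union_inter (s₁ := S \ T) (s₂ := P.filter fun u => ∃ v ∈ T, E u v) (f := w)
  have h3 : 0 ≤ ∑ v ∈ (S \ T) ∩ P.filter fun u => ∃ v ∈ T, E u v, w v :=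
    Finset.sum_nonneg fun _ _ => hw _
  have h4 := Finset.sum_sdiff (f := w) hTS
  linarith

open Classical in
/-- In a weighted commutative graph, the inner vertices of a separating set of minimal weight can be
replaced by their reachable predecessors without increasing the weight. -/
theorem Separates.weight_pred_le {w : V → ℝ} {𝒱 T P : Finset V} {σ : V → V → V → V}
    (hE𝒱 : ∀ u v, E u v → u ∈ 𝒱 ∧ v ∈ 𝒱)
    (hEbot : ∀ u v, E u v → ¬ bot v) (hEtop : ∀ u v, E u v → ¬ top u)
    (hσ₁ : ∀ u v x, E u v → E v x → E u (σ u v x) ∧ E (σ u v x) x)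
    (hσ₂ : ∀ u v x x', E u v → E v x → E v x' → σ u v x = σ u v x' → x = x')
    (hσ₃ : ∀ u u' v x, E u v → E u' v → E v x → σ u v x = σ u' v x → u = u')
    (hσ₄ : ∀ u v x, E u v → E v x → w (σ u v x) * w v = w u * w x)
    (hw : ∀ v, 0 < w v) (hS𝒱 : S ⊆ 𝒱) (h : Separates E bot top S)
    (hmin : ∀ S' ⊆ 𝒱, Separates E bot top S' → ∑ v ∈ S, w v ≤ ∑ v ∈ S', w v)
    (hT : T = S.filter fun v => ¬ bot v ∧ ¬ top v)
    (hP : P = 𝒱.filter fun u => Up E bot S u ∧ ∃ v ∈ T, E u v) :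
    ∑ u ∈ P, w u ≤ ∑ v ∈ T, w v := by
  set N : Finset V := 𝒱.filter fun x => Up (fun x y => E y x) top S x ∧ ∃ v ∈ T, E v x with hN
  have hTS : T ⊆ S := hT ▸ Finset.filter_subset _ _
  have hmT : ∀ u v x, u ∈ P → x ∈ N → E u v → E v x → v ∈ T := by
    intro u v x hu hx huv hvx
    rw [hP, Finset.mem_filter] at hu
    rw [hN, Finset.mem_filter] at hx
    rw [hT, Finset.mem_filter]
    exact ⟨h.mem_of_adj_adj hu.2.1 huv hvx hx.2.1, hEbot u v huv, hEtop v x hvx⟩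
  have hw' : ∀ v, 0 ≤ w v := fun v => (hw v).le
  -- Out-degrees are plain counts, while in-degrees carry quotients of weights, so that edge sums
  -- taken from either end agree (`hcount`). Completing squares with `σ` gives the degree
  -- inequalities `hdeg` and `hdeg'`.
  set dp : V → ℝ := fun v => ((N.filter fun x => E v x).card : ℝ) with hdp
  set dq : V → ℝ := fun u => ((T.filter fun v => E u v).card : ℝ) with hdq
  set ep : V → ℝ := fun v => ∑ u ∈ P with E u v, w u / w v with hep
  set eq : V → ℝ := fun x => ∑ v ∈ T with E v x, w v / w x with heq
  have hexpP : ∀ T' ⊆ T, ∑ v ∈ T', w v ≤ ∑ u ∈ P with ∃ v ∈ T', E u v, w u := by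
    intro T' hT'
    refine h.weight_le_of_minimal hS𝒱 hmin hw' (hT'.trans hTS) ?_ (hP ▸ Finset.filter_subset _ _) ?_
    · intro v hv
      have := hT' hv
      rw [hT, Finset.mem_filter] at this
      exact this.2.1
    · rintro u hu ⟨v, hv, huv⟩
      rw [hP, Finset.mem_filter]
      exact ⟨(hE𝒱 u v huv).1, hu, v, hT' hv, huv⟩
  have hexpN : ∀ T' ⊆ T, ∑ v ∈ T', w v ≤ ∑ u ∈ N with ∃ v ∈ T', E v u, w u := by
    intro T' hT'
    refine h.symm.weight_le_of_minimal hS𝒱 (fun S' h1 h2 => hmin S' h1 h2.symm) hw'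
      (hT'.trans hTS) ?_ (Finset.filter_subset _ _) ?_
    · intro v hv
      have := hT' hv
      rw [hT, Finset.mem_filter] at this
      exact this.2.2
    · rintro u hu ⟨v, hv, huv⟩
      rw [hN, Finset.mem_filter]
      exact ⟨(hE𝒱 v u huv).2, hu, v, hT' hv, huv⟩
  have hdeg : ∀ u ∈ P, ∀ v ∈ T, E u v → dp v ≤ dq u := by
    intro u hu v hv huv
    simp only [hdp, hdq]
    norm_cast
    refine Finset.card_le_card_of_injOn (σ u v) ?_ ?_
    · intro x hx
      simp only [Finset.coe_filter, Set.mem_ofPred_eq] at hx ⊢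
      have := hσ₁ u v x huv hx.2
      exact ⟨hmT u _ x hu hx.1 this.1 this.2, this.1⟩
    · intro x hx x' hx' hxx
      simp only [Finset.coe_filter, Set.mem_ofPred_eq] at hx hx'
      exact hσ₂ u v x x' huv hx.2 hx'.2 hxx
  have hdeg' : ∀ x ∈ N, ∀ v ∈ T, E v x → ep v ≤ eq x := by
    intro x hx v hv hvx
    simp only [hep, heq]
    calc ∑ u ∈ P with E u v, w u / w v
        = ∑ u ∈ P with E u v, w (σ u v x) / w x := by
          refine Finset.sum_congr rfl fun u hu => ?_
          rw [div_eq_div_iff (hw _).ne' (hw _).ne']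
          exact (hσ₄ u v x (Finset.mem_filter.1 hu).2 hvx).symm
      _ = ∑ y ∈ (P.filter fun u => E u v).image (fun u => σ u v x), w y / w x := by
          rw [Finset.sum_image]
          intro u hu u' hu' huu
          simp only [Finset.coe_filter, Set.mem_ofPred_eq] at hu hu'
          exact hσ₃ u u' v x hu.2 hu'.2 hvx huu
      _ ≤ _ := by
          refine Finset.sum_le_sum_of_subset_of_nonneg ?_ fun y _ _ => div_nonneg (hw' _) (hw' _)
          intro y hy
          simp only [Finset.mem_image, Finset.mem_filter] at hy ⊢
          obtain ⟨u, ⟨hu, huv⟩, rfl⟩ := hy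
          have := hσ₁ u v x huv hvx
          exact ⟨hmT u _ x hu hx this.1 this.2, this.2⟩
  have hcount : ∀ (X Y : Finset V) , ∑ v ∈ X, w v * ((Y.filter fun x => E v x).card : ℝ) =
      ∑ x ∈ Y, w x * ∑ v ∈ X with E v x, w v / w x := by
    intro X Y
    calc _ = ∑ v ∈ X, ∑ x ∈ Y with E v x, w v :=
          Finset.sum_congr rfl fun v _ => by rw [Finset.sum_const, nsmul_eq_mul, mul_comm]
      _ = ∑ x ∈ Y, ∑ v ∈ X with E v x, w v := by
          simp only [Finset.sum_filter]
          exact Finset.sum_comm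
      _ = _ := by
          refine Finset.sum_congr rfl fun x _ => ?_
          rw [Finset.mul_sum]
          exact Finset.sum_congr rfl fun v _ => by field_simp [(hw x).ne']
  -- The subtracted 1 brings in the weights of `P` and `T`. Since `h2`, `h3`, `h4` give ∑_P w·dq ≤
  -- ∑_T w·dp, only the desired inequality remains.
  have h1 : ∑ v ∈ T, w v * (dp v - 1) ≤ ∑ u ∈ P, w u * (dq u - 1) := by
    refine sum_mul_le_of_expanding (R := E) hw' hexpP ?_ ?_
    · intro u hu v hv huv
      linarith [hdeg u hu v hv huv]
    · intro u hu
      rw [hP, Finset.mem_filter] at hu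
      obtain ⟨_, _, v, hv, huv⟩ := hu
      have : 0 < (T.filter fun v => E u v).card :=
        Finset.card_pos.2 ⟨v, Finset.mem_filter.2 ⟨hv, huv⟩⟩
      have : (1 : ℝ) ≤ dq u := by simp only [hdq]; exact_mod_cast this
      linarith
  have h2 : ∑ v ∈ T, w v * ep v ≤ ∑ x ∈ N, w x * eq x :=
    sum_mul_le_of_expanding (R := fun x y => E y x) hw' hexpN hdeg'
      fun x _ => Finset.sum_nonneg fun v _ => div_nonneg (hw' _) (hw' _)
  have h3 : ∑ v ∈ T, w v * dp v = ∑ x ∈ N, w x * eq x := hcount T N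
  have h4 : ∑ u ∈ P, w u * dq u = ∑ v ∈ T, w v * ep v := hcount P T
  simp only [mul_sub, mul_one, Finset.sum_sub_distrib] at h1
  linarith

open Classical in
/-- In a weighted commutative graph some separating set of minimal weight consists of bottom and
top vertices. -/
theorem exists_separates_subset_bot_top {w : V → ℝ} {𝒱 S₀ : Finset V} {σ : V → V → V → V}
    {rank : V → ℕ}
    (hE𝒱 : ∀ u v, E u v → u ∈ 𝒱 ∧ v ∈ 𝒱) (hrank : ∀ u v, E u v → rank v = rank u + 1)
    (hbot : ∀ v, bot v ↔ rank v = 0) (hEtop : ∀ u v, E u v → ¬ top u)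
    (hσ₁ : ∀ u v x, E u v → E v x → E u (σ u v x) ∧ E (σ u v x) x)
    (hσ₂ : ∀ u v x x', E u v → E v x → E v x' → σ u v x = σ u v x' → x = x')
    (hσ₃ : ∀ u u' v x, E u v → E u' v → E v x → σ u v x = σ u' v x → u = u')
    (hσ₄ : ∀ u v x, E u v → E v x → w (σ u v x) * w v = w u * w x)
    (hw : ∀ v, 0 < w v) (hS₀ : S₀ ⊆ 𝒱) (h : Separates E bot top S₀) :
    ∃ S ⊆ 𝒱, Separates E bot top S ∧ (∀ v ∈ S, top v ∨ bot v) ∧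
      ∑ v ∈ S, w v ≤ ∑ v ∈ S₀, w v := by
  obtain ⟨S₁, hS₁, hS₁min⟩ := Finset.exists_min_image
    (𝒱.powerset.filter fun S => Separates E bot top S) (fun S => ∑ v ∈ S, w v)
    ⟨S₀, by simp [hS₀, h]⟩
  simp only [Finset.mem_filter, Finset.mem_powerset] at hS₁ hS₁min
  -- `n` bounds the rank of the non-top vertices; replacing the inner ones by predecessors lowers it
  -- by one.
  have key : ∀ n : ℕ, ∀ S ⊆ 𝒱, Separates E bot top S → ∑ v ∈ S, w v ≤ ∑ v ∈ S₁, w v →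
      (∀ v ∈ S, top v ∨ rank v ≤ n) → ∃ S ⊆ 𝒱, Separates E bot top S ∧
        (∀ v ∈ S, top v ∨ bot v) ∧ ∑ v ∈ S, w v ≤ ∑ v ∈ S₁, w v := by
    intro n
    induction n with
    | zero =>
      intro S hS hsep hle hr
      exact ⟨S, hS, hsep, fun v hv => (hr v hv).imp_right fun h => (hbot v).2 (by omega), hle⟩
    | succ n ih =>
      intro S hS hsep hle hr
      set T := S.filter fun v => ¬ bot v ∧ ¬ top v with hT
      set P := 𝒱.filter fun u => Up E bot S u ∧ ∃ v ∈ T, E u v with hP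
      have hle' := hsep.weight_pred_le hE𝒱
        (fun u v huv hb => by have := hrank u v huv; have := (hbot v).1 hb; omega) hEtop
        hσ₁ hσ₂ hσ₃ hσ₄ hw hS (fun S' h1 h2 => hle.trans (hS₁min S' ⟨h1, h2⟩)) hT hP
      refine ih (S \ T ∪ P)
        (Finset.union_subset (Finset.sdiff_subset.trans hS) (Finset.filter_subset _ _))
        (hsep.replace (fun v hv => (Finset.mem_filter.1 hv).2.1) ?_) ?_ ?_
      · rintro u hu ⟨v, hv, huv⟩
        exact Finset.mem_filter.2 ⟨(hE𝒱 u v huv).1, hu, v, hv, huv⟩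
      · have h2 := Finset.sum_union_inter (s₁ := S \ T) (s₂ := P) (f := w)
        have h3 : 0 ≤ ∑ v ∈ (S \ T) ∩ P, w v := Finset.sum_nonneg fun _ _ => (hw _).le
        have h4 := Finset.sum_sdiff (f := w) (Finset.filter_subset _ _ : T ⊆ S)
        linarith
      · intro v hv
        rcases Finset.mem_union.1 hv with hv | hv
        · rw [Finset.mem_sdiff] at hv
          by_cases ht : top v
          · exact Or.inl ht
          · right
            by_contra hlt
            refine hv.2 (Finset.mem_filter.2 ⟨hv.1, fun hb => ?_, ht⟩)
            have := (hbot v).1 hb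
            omega
        · obtain ⟨_, _, y, hy, hvy⟩ := Finset.mem_filter.1 hv
          right
          have h1 := hrank v y hvy
          have hyT := Finset.mem_filter.1 hy
          rcases hr y hyT.1 with h2 | h2
          · exact absurd h2 hyT.2.2
          · omega
  obtain ⟨S, h1, h2, h3, h4⟩ := key (S₁.sup rank) S₁ hS₁.1 hS₁.2 le_rfl
    fun v hv => Or.inr (Finset.le_sup hv)
  exact ⟨S, h1, h2, h3, h4.trans (hS₁min S₀ ⟨hS₀, h⟩)⟩

end Cut

end DifferentSummands

namespace DifferentSummands

/-! ### The weighted Plünnecke inequality -/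

section Sumsets

variable {G : Type*} [AddCommGroup G] [DecidableEq G] {ι : Type*} [DecidableEq ι]

open Classical in
/-- A weighted form of Plünnecke's inequality for sums of different sets. -/
theorem card_le_sum_weight_of_magnification {A : Finset G} {B : ι → Finset G} {K : Finset ι} {D : ℝ}
    {ω : ι → ℝ} (hω : ∀ i, 0 < ω i) (hD : ∀ X ⊆ A, D * X.card ≤ ((X + ∑ i ∈ K, B i).card : ℝ))
    (hDω : D * ∏ i ∈ K, ω i = 1) {l : ℕ} (hl : 1 ≤ l) (hlK : l ≤ K.card) :
    (A.card : ℝ) ≤ ∑ L ∈ K.powersetCard l, (∏ i ∈ L, ω i) * ((A + ∑ i ∈ L, B i).card : ℝ) := by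
  set 𝒱 : Finset (Finset ι × G) :=
    K.powerset.biUnion fun I => (A + ∑ i ∈ I, B i).image fun x => (I, x) with h𝒱
  have mem𝒱 : ∀ v : Finset ι × G, v ∈ 𝒱 ↔ v.1 ⊆ K ∧ v.2 ∈ A + ∑ i ∈ v.1, B i := by
    rintro ⟨I, x⟩
    simp only [h𝒱, Finset.mem_biUnion, Finset.mem_powerset, Finset.mem_image, Prod.mk.injEq]
    constructor
    · rintro ⟨J, hJ, y, hy, rfl, rfl⟩
      exact ⟨hJ, hy⟩
    · rintro ⟨hI, hx⟩
      exact ⟨I, hI, x, hx, rfl, rfl⟩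
  set E : Finset ι × G → Finset ι × G → Prop := fun u v => u ∈ 𝒱 ∧
    ∃ p ∈ K, p ∉ u.1 ∧ v.1 = insert p u.1 ∧ ∃ b ∈ B p, v.2 = u.2 + b with hE
  have step : ∀ I p x b, p ∉ I → x ∈ A + ∑ i ∈ I, B i → b ∈ B p →
      x + b ∈ A + ∑ i ∈ insert p I, B i := by
    intro I p x b hp hx hb
    rw [Finset.sum_insert hp, add_comm (B p), ← add_assoc]
    exact Finset.add_mem_add hx hb
  set bot : Finset ι × G → Prop := fun v => v.1.card = 0 with hbot
  set top : Finset ι × G → Prop := fun v => v ∈ 𝒱 ∧ v.1 = K with htop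
  set w : Finset ι × G → ℝ := fun v => ∏ i ∈ v.1, ω i with hw
  -- `σ` performs the two additions in the opposite order.
  set σ : Finset ι × G → Finset ι × G → Finset ι × G → Finset ι × G :=
    fun u v x => (u.1 ∪ (x.1 \ v.1), u.2 + (x.2 - v.2)) with hσ
  have hwpos : ∀ v, 0 < w v := fun v => Finset.prod_pos fun i _ => hω i
  have hE𝒱 : ∀ u v, E u v → u ∈ 𝒱 ∧ v ∈ 𝒱 := by
    rintro ⟨I, x⟩ ⟨J, y⟩ ⟨hu, p, hpK, hp, hJ, b, hb, hy⟩
    refine ⟨hu, ?_⟩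
    dsimp only at hJ hy hp
    subst hJ hy
    rw [mem𝒱] at hu ⊢
    exact ⟨Finset.insert_subset hpK hu.1, step I p x b hp hu.2 hb⟩
  have hrank : ∀ u v : Finset ι × G, E u v → v.1.card = u.1.card + 1 := by
    rintro u v ⟨hu, p, hpK, hp, hJ, b, hb, hy⟩
    rw [hJ, Finset.card_insert_of_notMem hp]
  have hσ₀ : ∀ u v x, E u v → E v x → ∃ p q b c, p ∈ K ∧ q ∈ K ∧ p ∉ u.1 ∧ q ∉ u.1 ∧ p ≠ q ∧
      b ∈ B p ∧ c ∈ B q ∧ v = (insert p u.1, u.2 + b) ∧ x = (insert q (insert p u.1), u.2 + b + c) ∧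
      σ u v x = (insert q u.1, u.2 + c) := by
    rintro ⟨I, x⟩ ⟨J, y⟩ ⟨L, z⟩ ⟨hu, p, hpK, hp, hJ, b, hb, hy⟩ ⟨hv, q, hqK, hq, hL, c, hc, hz⟩
    dsimp only at hJ hy hp hL hz hq
    subst hJ hy hL hz
    simp only [Finset.mem_insert, not_or] at hq
    refine ⟨p, q, b, c, hpK, hqK, hp, hq.2, fun h => hq.1 h.symm, hb, hc, rfl, rfl, ?_⟩
    simp only [hσ, Prod.mk.injEq]
    constructor
    · ext i
      simp only [Finset.mem_union, Finset.mem_sdiff, Finset.mem_insert]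
      by_cases hi : i = q
      · subst hi; simp [hq.1, hq.2]
      · simp only [hi, false_or]; tauto
    · abel
  -- These recovery formulas make `σ` injective in its last and in its first argument.
  have hσ₁ : ∀ u v x, E u v → E v x →
      x = ((σ u v x).1 ∪ v.1, (σ u v x).2 + (v.2 - u.2)) ∧
      u = ((σ u v x).1 ∩ v.1, (σ u v x).2 + (v.2 - x.2)) := by
    intro u v x huv hvx
    obtain ⟨p, q, b, c, -, -, hp, hq, hpq, -, -, hv, hx, hs⟩ := hσ₀ u v x huv hvx
    rw [hs, hv, hx]
    refine ⟨Prod.ext ?_ (by dsimp only; abel), Prod.ext ?_ (by dsimp only; abel)⟩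
    · ext i; simp only [Finset.mem_insert, Finset.mem_union]; tauto
    · ext i
      simp only [Finset.mem_insert, Finset.mem_inter]
      constructor
      · tauto
      · rintro ⟨rfl | h, rfl | h'⟩
        · exact absurd rfl hpq
        · exact absurd h' hq
        · exact h
        · exact h
  obtain ⟨S, hS𝒱, hsep, hSbt, hSle⟩ : ∃ S ⊆ 𝒱, Separates E bot top S ∧
      (∀ v ∈ S, top v ∨ bot v) ∧ ∑ v ∈ S, w v ≤ ∑ v ∈ 𝒱 with v.1.card = l, w v := by
    refine exists_separates_subset_bot_top (σ := σ) (rank := fun v => v.1.card) hE𝒱 hrank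
      (fun v => Iff.rfl) ?_ ?_ ?_ ?_ ?_ hwpos (Finset.filter_subset _ _) ?_
    · rintro u v ⟨hu, p, hpK, hp, _⟩ ⟨_, h⟩
      exact hp (h ▸ hpK)
    · intro u v x huv hvx
      obtain ⟨p, q, b, c, hpK, hqK, hp, hq, hpq, hb, hc, hv, hx, hs⟩ := hσ₀ u v x huv hvx
      have h1 : E u (σ u v x) := by
        rw [hs]
        exact ⟨huv.1, q, hqK, hq, rfl, c, hc, rfl⟩
      refine ⟨h1, (hE𝒱 _ _ h1).2, ?_⟩
      rw [hs, hx]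
      refine ⟨p, hpK, by simp [hp, hpq], Finset.insert_comm _ _ _, b, hb, add_right_comm _ _ _⟩
    · intro u v x x' huv hvx hvx' h
      rw [(hσ₁ u v x huv hvx).1, (hσ₁ u v x' huv hvx').1, h]
    · intro u u' v x huv huv' hvx h
      rw [(hσ₁ u v x huv hvx).2, (hσ₁ u' v x huv' hvx).2, h]
    · intro u v x huv hvx
      obtain ⟨p, q, b, c, hpK, hqK, hp, hq, hpq, hb, hc, hv, hx, hs⟩ := hσ₀ u v x huv hvx
      rw [hs, hv, hx]
      simp only [hw]
      rw [Finset.prod_insert hq, Finset.prod_insert hp, Finset.prod_insert (by simp [hq, hpq.symm]),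
        Finset.prod_insert hp]
      ring
    · refine separates_of_forall_top ?_
      have hlt : ∀ v, Up E bot (𝒱.filter fun v => v.1.card = l) v → v.1.card < l := by
        intro v hv
        induction hv with
        | base v hb _ => exact (show v.1.card = 0 from hb) ▸ hl
        | step u v _ huv hvS ih =>
          have h1 := hrank u v huv
          have h2 : v.1.card ≠ l := fun h => hvS (Finset.mem_filter.2 ⟨(hE𝒱 u v huv).2, h⟩)
          omega
      intro v hv h
      have := hlt v h
      rw [hv.2] at this
      omega
  have hlevel : ∑ v ∈ 𝒱 with v.1.card = l, w v =
      ∑ L ∈ K.powersetCard l, (∏ i ∈ L, ω i) * ((A + ∑ i ∈ L, B i).card : ℝ) := by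
    have : 𝒱.filter (fun v => v.1.card = l) =
        (K.powersetCard l).biUnion fun I => (A + ∑ i ∈ I, B i).image fun x => (I, x) := by
      ext ⟨I, x⟩
      simp only [Finset.mem_filter, mem𝒱, Finset.mem_biUnion, Finset.mem_powersetCard,
        Finset.mem_image, Prod.mk.injEq]
      constructor
      · rintro ⟨⟨h1, h2⟩, h3⟩
        exact ⟨I, ⟨h1, h3⟩, x, h2, rfl, rfl⟩
      · rintro ⟨J, ⟨h1, h3⟩, y, h2, rfl, rfl⟩
        exact ⟨⟨h1, h2⟩, h3⟩
    rw [this, Finset.sum_biUnion]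
    · refine Finset.sum_congr rfl fun L _ => ?_
      rw [Finset.sum_image (by intro a _ b _ h; exact (Prod.mk.inj h).2)]
      simp only [hw]
      rw [Finset.sum_const, nsmul_eq_mul, mul_comm]
    · intro I _ J _ hIJ
      rw [Function.onFun, Finset.disjoint_left]
      rintro ⟨L, x⟩ h1 h2
      simp only [Finset.mem_image, Prod.mk.injEq] at h1 h2
      obtain ⟨_, _, rfl, _⟩ := h1
      obtain ⟨_, _, h, _⟩ := h2
      exact hIJ h.symm
  rw [← hlevel]
  refine le_trans ?_ hSle
  set X := A.filter fun a => ((∅ : Finset ι), a) ∉ S with hX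
  have hKpos : 1 ≤ K.card := hl.trans hlK
  -- As `S` has only bottom and top vertices, a path starting at a bottom vertex outside `S` cannot
  -- meet `S` before the top.
  have hup : ∀ a ∈ X, ∀ I : Finset ι, I ⊆ K → ∀ y ∈ ({a} : Finset G) + ∑ i ∈ I, B i,
      (I, y) ∈ 𝒱 ∧ ((I, y) ∉ S → Up E bot S (I, y)) := by
    intro a ha I
    have haX := Finset.mem_filter.1 ha
    induction I using Finset.induction_on with
    | empty =>
      intro _ y hy
      simp only [Finset.sum_empty, add_zero, Finset.mem_singleton] at hy
      subst hy
      refine ⟨(mem𝒱 _).2 ⟨by simp, by simpa using haX.1⟩, fun h => Up.base _ (by simp [hbot]) h⟩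
    | insert p I hp ih =>
      intro hI y hy
      rw [Finset.sum_insert hp, add_comm (B p), ← add_assoc] at hy
      obtain ⟨z, hz, b, hb, rfl⟩ := Finset.mem_add.1 hy
      have hpK := hI (Finset.mem_insert_self _ _)
      have hIK := (Finset.subset_insert p I).trans hI
      obtain ⟨h1, h2⟩ := ih hIK z hz
      have hadj : E (I, z) (insert p I, z + b) := ⟨h1, p, hpK, hp, rfl, b, hb, rfl⟩
      refine ⟨(hE𝒱 _ _ hadj).2, fun hS => Up.step _ _ (h2 fun hzS => ?_) hadj hS⟩
      rcases hSbt _ hzS with h | h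
      · exact hp ((show I = K from h.2).symm ▸ hpK)
      · have hI0 : I = ∅ := Finset.card_eq_zero.1 h
        subst hI0
        simp only [Finset.sum_empty, add_zero, Finset.mem_singleton] at hz
        subst hz
        exact haX.2 hzS
  have htopS : (X + ∑ i ∈ K, B i).image (fun x => (K, x)) ⊆ S := by
    intro v hv
    obtain ⟨y, hy, rfl⟩ := Finset.mem_image.1 hv
    obtain ⟨a, ha, s, hs, rfl⟩ := Finset.mem_add.1 hy
    obtain ⟨h1, h2⟩ := hup a ha K subset_rfl (a + s)
      (Finset.add_mem_add (Finset.mem_singleton_self a) hs)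
    by_contra hS
    exact hsep _ (h2 hS) (Up.base _ ⟨h1, rfl⟩ hS)
  have hbotS : (A \ X).image (fun x => ((∅ : Finset ι), x)) ⊆ S := by
    intro v hv
    obtain ⟨y, hy, rfl⟩ := Finset.mem_image.1 hv
    rw [Finset.mem_sdiff] at hy
    by_contra hS
    exact hy.2 (Finset.mem_filter.2 ⟨hy.1, hS⟩)
  have hdisj : Disjoint ((A \ X).image (fun x => ((∅ : Finset ι), x)))
      ((X + ∑ i ∈ K, B i).image (fun x => (K, x))) := by
    rw [Finset.disjoint_left]
    intro v h1 h2
    obtain ⟨y, _, rfl⟩ := Finset.mem_image.1 h1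
    obtain ⟨z, _, hz⟩ := Finset.mem_image.1 h2
    have := (Prod.mk.inj hz).1
    rw [this] at hKpos
    simp at hKpos
  have h1 := Finset.sum_le_sum_of_subset_of_nonneg (f := w)
    (Finset.union_subset hbotS htopS) fun v _ _ => (hwpos v).le
  rw [Finset.sum_union hdisj, Finset.sum_image (by intro a _ b _ h; exact (Prod.mk.inj h).2),
    Finset.sum_image (by intro a _ b _ h; exact (Prod.mk.inj h).2)] at h1
  simp only [hw, Finset.prod_empty, Finset.sum_const, nsmul_eq_mul, mul_one] at h1
  have hXA : X ⊆ A := Finset.filter_subset _ _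
  have h2 : ((A \ X).card : ℝ) + X.card = A.card := by
    exact_mod_cast Finset.card_sdiff_add_card_eq_card hXA
  have h3 := mul_le_mul_of_nonneg_right (hD X hXA)
    (Finset.prod_nonneg fun i (_ : i ∈ K) => (hω i).le)
  have h4 : D * (X.card : ℝ) * ∏ i ∈ K, ω i = X.card := by
    rw [mul_right_comm, hDω, one_mul]
  linarith

end Sumsets

end DifferentSummands

namespace DifferentSummands

/-! ### Products over subsets of fixed size -/

theorem prod_powersetCard_pred {ι : Type*} [DecidableEq ι] {R : Type*} [CommMonoid R]
    {K : Finset ι} {n : ℕ} (hK : K.card = n + 1) (f : Finset ι → R) :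
    ∏ L ∈ K.powersetCard n, f L = ∏ i ∈ K, f (K.erase i) := by
  symm
  refine Finset.prod_bij (fun i _ => K.erase i) ?_ ?_ ?_ fun _ _ => rfl
  · intro i hi
    rw [Finset.mem_powersetCard, Finset.card_erase_of_mem hi, hK]
    exact ⟨Finset.erase_subset _ _, rfl⟩
  · intro i hi j hj h
    by_contra hij
    have : j ∈ K.erase i := Finset.mem_erase.2 ⟨fun h => hij h.symm, hj⟩
    rw [h] at this
    exact absurd rfl (Finset.mem_erase.1 this).1
  · intro L hL
    rw [Finset.mem_powersetCard] at hL
    have h1 : (K \ L).card = 1 := by rw [Finset.card_sdiff_of_subset hL.1]; omega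
    obtain ⟨i, hi⟩ := Finset.card_eq_one.1 h1
    have hiK : i ∈ K \ L := hi ▸ Finset.mem_singleton_self i
    refine ⟨i, (Finset.mem_sdiff.1 hiK).1, ?_⟩
    rw [Finset.erase_eq, ← hi, Finset.sdiff_sdiff_eq_self hL.1]

/-- Each L arises as M ∖ {i} once for every i ∈ K ∖ L. -/
theorem prod_powersetCard_succ_prod_erase {ι : Type*} [DecidableEq ι] {R : Type*} [CommMonoid R]
    (K : Finset ι) (l : ℕ) (f : Finset ι → R) :
    ∏ M ∈ K.powersetCard (l + 1), ∏ i ∈ M, f (M.erase i) =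
      ∏ L ∈ K.powersetCard l, f L ^ (K.card - l) := by
  have : ∀ L ∈ K.powersetCard l, f L ^ (K.card - l) = ∏ i ∈ K \ L, f L := by
    intro L hL
    rw [Finset.mem_powersetCard] at hL
    rw [Finset.prod_const, Finset.card_sdiff_of_subset hL.1, hL.2]
  rw [Finset.prod_congr rfl this, Finset.prod_sigma', Finset.prod_sigma']
  refine Finset.prod_bij' (fun x _ => ⟨x.1.erase x.2, x.2⟩) (fun x _ => ⟨insert x.2 x.1, x.2⟩)
    ?_ ?_ ?_ ?_ ?_
  · rintro ⟨M, i⟩ h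
    simp only [Finset.mem_sigma, Finset.mem_powersetCard, Finset.mem_sdiff] at h ⊢
    obtain ⟨⟨h1, h2⟩, h3⟩ := h
    refine ⟨⟨(Finset.erase_subset _ _).trans h1, ?_⟩, h1 h3, Finset.notMem_erase _ _⟩
    rw [Finset.card_erase_of_mem h3, h2]; rfl
  · rintro ⟨L, i⟩ h
    simp only [Finset.mem_sigma, Finset.mem_powersetCard, Finset.mem_sdiff] at h ⊢
    obtain ⟨⟨h1, h2⟩, h3, h4⟩ := h
    exact ⟨⟨Finset.insert_subset h3 h1, by rw [Finset.card_insert_of_notMem h4, h2]⟩,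
      Finset.mem_insert_self _ _⟩
  · rintro ⟨M, i⟩ h
    simp only [Finset.mem_sigma] at h
    simp [Finset.insert_erase h.2]
  · rintro ⟨L, i⟩ h
    simp only [Finset.mem_sigma, Finset.mem_sdiff] at h
    simp [Finset.erase_insert h.2.2]
  · rintro ⟨M, i⟩ _
    rfl

/-! ### Growth ratios and the case l = k - 1 -/

section Ratios

variable {G : Type*} [AddCommGroup G] [DecidableEq G] {ι : Type*}

/-- The ratio `|A + ∑_{i ∈ I} B_i| / |A|`, for an arbitrary index type. -/
noncomputable def ratio (A : Finset G) (B : ι → Finset G) (I : Finset ι) : ℝ :=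
  ((A + ∑ i ∈ I, B i).card : ℝ) / (A.card : ℝ)

theorem ratio_nonneg (A : Finset G) (B : ι → Finset G) (I : Finset ι) : 0 ≤ ratio A B I := by
  unfold ratio; positivity

/-- Passing to a subset of at least `|A| / N` elements increases the ratios at most `N`-fold. -/
theorem ratio_le_mul_of_subset {A A' : Finset G} (B : ι → Finset G) (I : Finset ι) {N : ℝ}
    (hA' : A' ⊆ A) (hne : A'.Nonempty) (hN : (A.card : ℝ) ≤ N * A'.card) :
    ratio A' B I ≤ N * ratio A B I := by
  have h0 : (0 : ℝ) < A'.card := by exact_mod_cast hne.card_pos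
  have h1 : (0 : ℝ) < A.card := by exact_mod_cast (hne.mono hA').card_pos
  have h2 : ((A' + ∑ i ∈ I, B i).card : ℝ) ≤ (A + ∑ i ∈ I, B i).card := by
    exact_mod_cast Finset.card_le_card (Finset.add_subset_add_right hA')
  unfold ratio
  rw [div_le_iff₀ h0]
  have h3 : 0 ≤ ((A + ∑ i ∈ I, B i).card : ℝ) / A.card := by positivity
  calc ((A' + ∑ i ∈ I, B i).card : ℝ) ≤ (A + ∑ i ∈ I, B i).card := h2
    _ = ((A + ∑ i ∈ I, B i).card : ℝ) / A.card * A.card := by field_simp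
    _ ≤ ((A + ∑ i ∈ I, B i).card : ℝ) / A.card * (N * A'.card) :=
        mul_le_mul_of_nonneg_left hN h3
    _ = _ := by ring

theorem exists_min_ratio {A : Finset G} (hA : A.Nonempty) (S : Finset G) :
    ∃ X ⊆ A, X.Nonempty ∧ ∀ Y ⊆ A,
      ((X + S).card : ℝ) / X.card * Y.card ≤ ((Y + S).card : ℝ) := by
  obtain ⟨X, hX, hmin⟩ := Finset.exists_min_image (A.powerset.filter fun X => X.Nonempty)
    (fun X => ((X + S).card : ℝ) / X.card) ⟨A, by simp [hA]⟩
  simp only [Finset.mem_filter, Finset.mem_powerset] at hX hmin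
  refine ⟨X, hX.1, hX.2, fun Y hY => ?_⟩
  rcases Y.eq_empty_or_nonempty with rfl | hne
  · simp
  · have h0 : (0 : ℝ) < Y.card := by exact_mod_cast hne.card_pos
    rw [← le_div_iff₀ h0]
    exact hmin Y ⟨hY, hne⟩

variable [DecidableEq ι]

/-- Weights ω_i = c·a_i, with a_i the ratio of K ∖ {i}, make all n + 1 terms of layer n equal, so
the weighted inequality reads Dc ≤ n + 1. The condition D∏ω = 1 fixes c, and the (n+1)-st power
eliminates it. -/
theorem magnification_pow_le {A : Finset G} {B : ι → Finset G} {K : Finset ι} {D : ℝ} {n : ℕ}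
    (hn : 1 ≤ n) (hK : K.card = n + 1) (hA : A.Nonempty) (hD0 : 0 < D)
    (hD : ∀ X ⊆ A, D * X.card ≤ ((X + ∑ i ∈ K, B i).card : ℝ)) :
    D ^ n ≤ ((n : ℝ) + 1) ^ (n + 1) * ∏ i ∈ K, ratio A B (K.erase i) := by
  have hm : (0 : ℝ) < A.card := by exact_mod_cast hA.card_pos
  have hne : (A + ∑ i ∈ K, B i).Nonempty := by
    rw [← Finset.card_pos]
    have := (mul_pos hD0 hm).trans_le (hD A subset_rfl)
    exact_mod_cast this
  set a : ι → ℝ := fun i => ratio A B (K.erase i) with ha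
  have hapos : ∀ i ∈ K, 0 < a i := by
    intro i hi
    rw [← Finset.add_sum_erase K B hi, add_comm (B i), ← add_assoc] at hne
    have := hne.of_add_left
    have h : (0 : ℝ) < (A + ∑ j ∈ K.erase i, B j).card := by exact_mod_cast this.card_pos
    exact div_pos h hm
  have hprod : 0 < ∏ i ∈ K, a i := Finset.prod_pos hapos
  set c : ℝ := (1 / (D * ∏ i ∈ K, a i)) ^ ((1 : ℝ) / ((n + 1 : ℕ) : ℝ)) with hc
  have hcpos : 0 < c := by positivity
  have hcpow : c ^ (n + 1) = 1 / (D * ∏ i ∈ K, a i) := by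
    rw [hc, ← Real.rpow_natCast, ← Real.rpow_mul (by positivity), one_div_mul_cancel (by positivity),
      Real.rpow_one]
  set ω : ι → ℝ := fun i => if i ∈ K then c * a i else 1 with hω
  have hωpos : ∀ i, 0 < ω i := by
    intro i
    simp only [hω]
    split_ifs with h
    · exact mul_pos hcpos (hapos i h)
    · exact one_pos
  have hωK : ∏ i ∈ K, ω i = c ^ (n + 1) * ∏ i ∈ K, a i := by
    rw [← hK, ← Finset.prod_const, ← Finset.prod_mul_distrib]
    exact Finset.prod_congr rfl fun i hi => if_pos hi
  have hDω : D * ∏ i ∈ K, ω i = 1 := by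
    rw [hωK, hcpow]; field_simp
  have h := card_le_sum_weight_of_magnification hωpos hD hDω hn (by omega)
  -- `Multiplicative ℝ` turns the product identity into one for sums.
  have hre : ∀ f : Finset ι → ℝ, ∑ L ∈ K.powersetCard n, f L = ∑ i ∈ K, f (K.erase i) :=
    fun f => prod_powersetCard_pred (R := Multiplicative ℝ) hK f
  rw [hre] at h
  have hterm : ∀ i ∈ K, (∏ j ∈ K.erase i, ω j) * ((A + ∑ j ∈ K.erase i, B j).card : ℝ) =
      A.card / (D * c) := by
    intro i hi
    have h1 := Finset.mul_prod_erase K ω hi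
    have h2 : ((A + ∑ j ∈ K.erase i, B j).card : ℝ) = a i * A.card := by
      simp only [ha, ratio]; field_simp
    have h3 : ω i = c * a i := if_pos hi
    rw [h3] at h1
    rw [h2, eq_div_iff (by positivity)]
    calc _ = D * (c * a i * ∏ j ∈ K.erase i, ω j) * A.card := by ring
      _ = _ := by rw [h1, hDω, one_mul]
  rw [Finset.sum_congr rfl hterm, Finset.sum_const, nsmul_eq_mul, hK, ← mul_div_assoc,
    le_div_iff₀ (by positivity), mul_comm, mul_le_mul_iff_left₀ hm] at h
  have h4 := pow_le_pow_left₀ (by positivity) h (n + 1)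
  rw [mul_pow, hcpow, pow_succ] at h4
  have h5 : D ^ n * D * (1 / (D * ∏ i ∈ K, a i)) = D ^ n / ∏ i ∈ K, a i := by field_simp
  rw [h5, div_le_iff₀ hprod] at h4
  exact_mod_cast h4

theorem exists_subset_card_add_le_pred {A : Finset G} (B : ι → Finset G) {K : Finset ι} {n : ℕ}
    (hn : 1 ≤ n) (hK : K.card = n + 1) (hA : A.Nonempty) :
    ∃ X ⊆ A, X.Nonempty ∧ ((X + ∑ i ∈ K, B i).card : ℝ) ≤
      (((n : ℝ) + 1) ^ (n + 1) * ∏ i ∈ K, ratio A B (K.erase i)) ^ (1 / (n : ℝ)) * X.card := by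
  obtain ⟨X, hXA, hX, hmin⟩ := exists_min_ratio hA (∑ i ∈ K, B i)
  have h0 : (0 : ℝ) < X.card := by exact_mod_cast hX.card_pos
  have hp : 0 ≤ ((n : ℝ) + 1) ^ (n + 1) * ∏ i ∈ K, ratio A B (K.erase i) :=
    mul_nonneg (pow_nonneg (by positivity) _) (Finset.prod_nonneg fun i _ => ratio_nonneg _ _ _)
  refine ⟨X, hXA, hX, ?_⟩
  rw [← div_le_iff₀ h0]
  rcases (div_nonneg (Nat.cast_nonneg _) h0.le :
    0 ≤ ((X + ∑ i ∈ K, B i).card : ℝ) / X.card).eq_or_lt with h | h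
  · rw [← h]; exact Real.rpow_nonneg hp _
  · have := magnification_pow_le hn hK hA h hmin
    have hn0 : (0 : ℝ) < n := by exact_mod_cast hn
    rw [one_div]
    refine (Real.le_rpow_inv_iff_of_pos h.le hp hn0).2 ?_
    rwa [Real.rpow_natCast]

/-- If every large subset of `A` contains a nonempty set that grows little, then so does
almost all of `A`. -/
theorem exists_large_of_exists_nonempty {A S : Finset G} {c r : ℝ}
    (h : ∀ A' ⊆ A, A'.Nonempty → r ≤ A'.card →
      ∃ X ⊆ A', X.Nonempty ∧ ((X + S).card : ℝ) ≤ c * X.card) (hr : 0 < r) :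
    ∃ X ⊆ A, ((A \ X).card : ℝ) < r ∧ ((X + S).card : ℝ) ≤ c * X.card := by
  -- A largest X works: a good Y in a large remainder could be joined to it, as |X + S| is
  -- subadditive under unions.
  obtain ⟨X, hX, hmax⟩ := Finset.exists_max_image
    (A.powerset.filter fun X => ((X + S).card : ℝ) ≤ c * X.card) Finset.card ⟨∅, by simp⟩
  simp only [Finset.mem_filter, Finset.mem_powerset] at hX hmax
  refine ⟨X, hX.1, ?_, hX.2⟩
  by_contra hlt
  rw [not_lt] at hlt
  obtain ⟨Y, hY, hYne, hYc⟩ := h (A \ X) Finset.sdiff_subset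
    (by rw [← Finset.card_pos]; exact_mod_cast hr.trans_le hlt) hlt
  have hdisj : Disjoint X Y := Finset.disjoint_of_subset_right hY Finset.disjoint_sdiff
  have h1 := hmax (X ∪ Y) ⟨Finset.union_subset hX.1 (hY.trans Finset.sdiff_subset), ?_⟩
  · rw [Finset.card_union_of_disjoint hdisj] at h1
    have := hYne.card_pos
    omega
  · rw [Finset.union_add, Finset.card_union_of_disjoint hdisj]
    have : (((X + S) ∪ (Y + S)).card : ℝ) ≤ (X + S).card + (Y + S).card := by
      exact_mod_cast Finset.card_union_le _ _
    push_cast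
    linarith [hX.2]

end Ratios

end DifferentSummands

namespace DifferentSummands

/-! ### Induction on k - l, up to a constant -/

/-- The exponent `(l-1)! (k-l)! / (k-1)!`. -/
noncomputable def expo (k l : ℕ) : ℝ :=
  (((l - 1)! : ℕ) : ℝ) * (((k - l)! : ℕ) : ℝ) / (((k - 1)! : ℕ) : ℝ)

theorem expo_nonneg (k l : ℕ) : 0 ≤ expo k l := by unfold expo; positivity

theorem expo_self (k : ℕ) : expo k k = 1 := by
  unfold expo
  have : (((k - 1)! : ℕ) : ℝ) ≠ 0 := by exact_mod_cast Nat.factorial_ne_zero _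
  rw [Nat.sub_self, Nat.factorial_zero, Nat.cast_one, mul_one, div_self this]

/-- Bookkeeping for the descent from l + 1 to l: 1/l comes from the root in the case k = l + 1, and
k - l counts the M above a given L. -/
theorem expo_succ {k l : ℕ} (hl : 1 ≤ l) (hlk : l < k) :
    expo k (l + 1) / l * ((k - l : ℕ) : ℝ) = expo k l := by
  obtain ⟨l, rfl⟩ : ∃ n, l = n + 1 := ⟨l - 1, by omega⟩
  obtain ⟨d, rfl⟩ : ∃ d, k = l + 1 + (d + 1) := ⟨k - l - 2, by omega⟩
  have h1 : l + 1 + (d + 1) - (l + 1) = d + 1 := by omega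
  have h2 : l + 1 + (d + 1) - (l + 1 + 1) = d := by omega
  have h3 : (((l + 1 + (d + 1) - 1)! : ℕ) : ℝ) ≠ 0 := by exact_mod_cast Nat.factorial_ne_zero _
  unfold expo
  rw [h1, h2, Nat.add_sub_cancel, Nat.add_sub_cancel, Nat.factorial_succ l, Nat.factorial_succ d]
  push_cast
  field_simp

/-- The total degree of β in the ratios; this is the source of the power k/l. -/
theorem expo_mul_choose {k l : ℕ} (hl : 1 ≤ l) (hlk : l ≤ k) :
    expo k l * (k.choose l : ℝ) = (k : ℝ) / l := by
  have h := Nat.choose_mul_factorial_mul_factorial hlk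
  obtain ⟨l, rfl⟩ : ∃ n, l = n + 1 := ⟨l - 1, by omega⟩
  obtain ⟨k, rfl⟩ : ∃ n, k = n + 1 := ⟨k - 1, by omega⟩
  rw [Nat.factorial_succ l, Nat.factorial_succ k] at h
  have h' : ((k + 1).choose (l + 1) : ℝ) * (((l : ℝ) + 1) * (l ! : ℕ)) * ((k + 1 - (l + 1))! : ℕ) =
    ((k : ℝ) + 1) * (k ! : ℕ) := by exact_mod_cast h
  have h3 : ((k ! : ℕ) : ℝ) ≠ 0 := by exact_mod_cast Nat.factorial_ne_zero _
  rw [Nat.add_sub_add_right] at h'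
  unfold expo
  rw [Nat.add_sub_cancel, Nat.add_sub_cancel, Nat.add_sub_add_right]
  push_cast
  field_simp
  linarith

/-- The growth bound up to a constant that does not depend on the sets. -/
theorem exists_const_card_add_le.{u, v} {ι : Type v} [DecidableEq ι] (d : ℕ) :
    ∀ l : ℕ, 1 ≤ l → ∃ C : ℝ, 1 ≤ C ∧
      ∀ (G : Type u) [AddCommGroup G] [DecidableEq G] (A : Finset G) (B : ι → Finset G)
        (K : Finset ι), K.card = l + d → A.Nonempty →
        ∃ X ⊆ A, X.Nonempty ∧ ((X + ∑ i ∈ K, B i).card : ℝ) ≤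
          C * (∏ L ∈ K.powersetCard l, ratio A B L ^ expo (l + d) l) * X.card := by
  induction d with
  | zero =>
    intro l hl
    refine ⟨1, le_rfl, fun G _ _ A B K hK hA => ⟨A, subset_rfl, hA, ?_⟩⟩
    have h0 : (0 : ℝ) < A.card := by exact_mod_cast hA.card_pos
    rw [add_zero] at hK
    rw [add_zero, expo_self, ← hK, Finset.powersetCard_self, Finset.prod_singleton, Real.rpow_one,
      one_mul, ratio, div_mul_cancel₀ _ h0.ne']
  | succ d ih =>
    intro l hl
    obtain ⟨C', hC', ih⟩ := ih (l + 1) (by omega)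
    set k := l + (d + 1) with hk
    have hk' : l + 1 + d = k := by omega
    rw [hk'] at ih
    have hl0 : (0 : ℝ) < l := by exact_mod_cast hl
    -- Each `X M` misses fewer than |A|/N elements, so the intersection `Y` of them all keeps at
    -- least half of A.
    set N : ℝ := 2 * (k.choose (l + 1) : ℝ) with hN
    have hchoose : 1 ≤ k.choose (l + 1) := Nat.choose_pos (by omega)
    have hchoose' : (1 : ℝ) ≤ k.choose (l + 1) := by exact_mod_cast hchoose
    have hN1 : 1 ≤ N := by rw [hN]; linarith
    have hN0 : 0 < N := by linarith
    -- Each of the l + 1 ratios loses a factor N when A is replaced by a subset of size at least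
    -- |A|/N. The 2 in `R` pays for passing from `X M` to `Y`.
    set Q : ℝ := ((l : ℝ) + 1) ^ (l + 1) * N ^ (l + 1) with hQ
    have hQ1 : 1 ≤ Q := one_le_mul_of_one_le_of_one_le (one_le_pow₀ (by linarith)) (one_le_pow₀ hN1)
    set R : ℝ := 2 * Q ^ (1 / (l : ℝ)) with hR
    have hR1 : 1 ≤ R := by
      have := Real.one_le_rpow hQ1 (by positivity : 0 ≤ 1 / (l : ℝ))
      rw [hR]; linarith
    have hR0 : 0 ≤ R := by linarith
    refine ⟨C' * (R ^ expo k (l + 1)) ^ (k.choose (l + 1)),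
      one_le_mul_of_one_le_of_one_le hC'
        (one_le_pow₀ (Real.one_le_rpow hR1 (expo_nonneg _ _))), ?_⟩
    intro G _ _ A B K hK hA
    have h0 : (0 : ℝ) < A.card := by exact_mod_cast hA.card_pos
    set p : Finset ι → ℝ := fun M => ∏ i ∈ M, ratio A B (M.erase i) with hp
    have hp0 : ∀ M, 0 ≤ p M := fun M => Finset.prod_nonneg fun i _ => ratio_nonneg _ _ _
    have hlarge : ∀ M ∈ K.powersetCard (l + 1), ∃ X ⊆ A, ((A \ X).card : ℝ) < A.card / N ∧
        ((X + ∑ i ∈ M, B i).card : ℝ) ≤ (Q * p M) ^ (1 / (l : ℝ)) * X.card := by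
      intro M hM
      rw [Finset.mem_powersetCard] at hM
      refine exists_large_of_exists_nonempty ?_ (by positivity)
      intro A' hA' hne hcard
      obtain ⟨X, hX, hXne, hXc⟩ := exists_subset_card_add_le_pred B hl hM.2 hne
      refine ⟨X, hX, hXne, hXc.trans ?_⟩
      refine mul_le_mul_of_nonneg_right ?_ (Nat.cast_nonneg _)
      refine Real.rpow_le_rpow
        (mul_nonneg (by positivity) (Finset.prod_nonneg fun i _ => ratio_nonneg _ _ _)) ?_
        (by positivity)
      rw [hQ, mul_assoc]
      refine mul_le_mul_of_nonneg_left ?_ (by positivity)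
      rw [← hM.2, ← Finset.prod_const, ← Finset.prod_mul_distrib]
      refine Finset.prod_le_prod (fun i _ => ratio_nonneg _ _ _) fun i _ => ?_
      refine ratio_le_mul_of_subset B _ hA' hne ?_
      rwa [div_le_iff₀ hN0, mul_comm] at hcard
    choose! X hXA hXlarge hXc using hlarge
    set Y : Finset G := A \ (K.powersetCard (l + 1)).biUnion fun M => A \ X M with hY
    have hYA : Y ⊆ A := Finset.sdiff_subset
    have hYX : ∀ M ∈ K.powersetCard (l + 1), Y ⊆ X M := by
      intro M hM x hx
      rw [hY, Finset.mem_sdiff, Finset.mem_biUnion] at hx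
      by_contra h
      exact hx.2 ⟨M, hM, Finset.mem_sdiff.2 ⟨hx.1, h⟩⟩
    have hYcard : (A.card : ℝ) ≤ 2 * Y.card := by
      have h1 : (((K.powersetCard (l + 1)).biUnion fun M => A \ X M).card : ℝ) ≤
          ∑ M ∈ K.powersetCard (l + 1), ((A \ X M).card : ℝ) := by
        exact_mod_cast Finset.card_biUnion_le
      have h2 : ∑ M ∈ K.powersetCard (l + 1), ((A \ X M).card : ℝ) ≤
          ∑ M ∈ K.powersetCard (l + 1), (A.card : ℝ) / N :=
        Finset.sum_le_sum fun M hM => (hXlarge M hM).le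
      have h3 : ∑ M ∈ K.powersetCard (l + 1), (A.card : ℝ) / N = A.card / 2 := by
        rw [Finset.sum_const, Finset.card_powersetCard, hK, nsmul_eq_mul, hN]
        field_simp
      have h4 : A.card ≤ Y.card + ((K.powersetCard (l + 1)).biUnion fun M => A \ X M).card := by
        have : _ ≤ Y.card :=
          Finset.le_card_sdiff ((K.powersetCard (l + 1)).biUnion fun M => A \ X M) A
        omega
      have h5 : (A.card : ℝ) ≤
          Y.card + ((K.powersetCard (l + 1)).biUnion fun M => A \ X M).card := by
        exact_mod_cast h4
      linarith
    have hYpos : (0 : ℝ) < Y.card := by linarith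
    have hYne : Y.Nonempty := Finset.card_pos.1 (by exact_mod_cast hYpos)
    obtain ⟨Z, hZY, hZ, hZc⟩ := ih G Y B K hK hYne
    refine ⟨Z, hZY.trans hYA, hZ, hZc.trans ?_⟩
    refine mul_le_mul_of_nonneg_right ?_ (Nat.cast_nonneg _)
    rw [mul_assoc C']
    refine mul_le_mul_of_nonneg_left ?_ (by linarith)
    have hrY : ∀ M ∈ K.powersetCard (l + 1), ratio Y B M ≤ R * p M ^ (1 / (l : ℝ)) := by
      intro M hM
      have h1 : ((Y + ∑ i ∈ M, B i).card : ℝ) ≤ (X M + ∑ i ∈ M, B i).card := by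
        exact_mod_cast Finset.card_le_card (Finset.add_subset_add_right (hYX M hM))
      have h2 : ((X M).card : ℝ) ≤ 2 * Y.card :=
        le_trans (by exact_mod_cast Finset.card_le_card (hXA M hM)) hYcard
      have h3 : 0 ≤ (Q * p M) ^ (1 / (l : ℝ)) :=
        Real.rpow_nonneg (mul_nonneg (by linarith) (hp0 M)) _
      have h4 := mul_le_mul_of_nonneg_left h2 h3
      rw [ratio, div_le_iff₀ hYpos, hR]
      rw [Real.mul_rpow (by linarith) (hp0 M)] at h4
      have h5 := hXc M hM
      rw [Real.mul_rpow (by linarith) (hp0 M)] at h5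
      linarith
    have hK' : K.card - l = k - l := by rw [hK]
    calc ∏ M ∈ K.powersetCard (l + 1), ratio Y B M ^ expo k (l + 1)
        ≤ ∏ M ∈ K.powersetCard (l + 1), (R * p M ^ (1 / (l : ℝ))) ^ expo k (l + 1) :=
          Finset.prod_le_prod (fun M _ => Real.rpow_nonneg (ratio_nonneg _ _ _) _) fun M hM =>
            Real.rpow_le_rpow (ratio_nonneg _ _ _) (hrY M hM) (expo_nonneg _ _)
      _ = ∏ M ∈ K.powersetCard (l + 1), (R ^ expo k (l + 1) *
            ∏ i ∈ M, ratio A B (M.erase i) ^ (expo k (l + 1) / l)) := by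
          refine Finset.prod_congr rfl fun M _ => ?_
          rw [Real.mul_rpow hR0 (Real.rpow_nonneg (hp0 M) _), ← Real.rpow_mul (hp0 M),
            Real.finsetProd_rpow _ _ fun i _ => ratio_nonneg _ _ _, one_div_mul_eq_div]
      _ = (R ^ expo k (l + 1)) ^ (k.choose (l + 1)) *
            ∏ L ∈ K.powersetCard l, (ratio A B L ^ (expo k (l + 1) / l)) ^ (k - l) := by
          rw [Finset.prod_mul_distrib, Finset.prod_const, Finset.card_powersetCard, hK,
            prod_powersetCard_succ_prod_erase K l fun L => ratio A B L ^ (expo k (l + 1) / l), hK']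
      _ = _ := by
          congr 1
          refine Finset.prod_congr rfl fun L _ => ?_
          rw [← Real.rpow_natCast, ← Real.rpow_mul (ratio_nonneg _ _ _),
            expo_succ hl (by omega : l < k)]

/-! ### Removing the constant by direct products -/

section Tensor

variable {G : Type*} [AddCommGroup G] [DecidableEq G] {ι : Type*}

theorem sum_product_self (B : ι → Finset G) (I : Finset ι) :
    ∑ i ∈ I, B i ×ˢ B i = (∑ i ∈ I, B i) ×ˢ (∑ i ∈ I, B i) := by
  classical
  induction I using Finset.induction_on with
  | empty => simp only [Finset.sum_empty]; rfl
  | insert i I hi ih =>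
    rw [Finset.sum_insert hi, Finset.sum_insert hi, ih, Finset.product_add_product_comm]

theorem ratio_product_self (A : Finset G) (B : ι → Finset G) (I : Finset ι) :
    ratio (A ×ˢ A) (fun i => B i ×ˢ B i) I = ratio A B I ^ 2 := by
  unfold ratio
  rw [sum_product_self, Finset.product_add_product_comm, Finset.card_product, Finset.card_product]
  push_cast
  rw [div_pow, sq, sq]

/-- Fibres over the second coordinate are copies of subsets of A, and adding S × {0} acts on each
separately. -/
theorem magnification_fst {H : Type*} [AddCommGroup H] [DecidableEq H] {A S : Finset G} {D : ℝ}
    (hD : ∀ X ⊆ A, D * X.card ≤ ((X + S).card : ℝ)) (Z : Finset (G × H))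
    (hZ : ∀ z ∈ Z, z.1 ∈ A) :
    D * Z.card ≤ ((Z + S ×ˢ ({0} : Finset H)).card : ℝ) := by
  set F : Finset (G × H) → H → Finset G := fun W h => (W.filter fun z => z.2 = h).image Prod.fst
    with hF
  have hFcard : ∀ W h, (F W h).card = (W.filter fun z => z.2 = h).card := by
    intro W h
    refine Finset.card_image_of_injOn ?_
    rintro ⟨x, y⟩ hx ⟨x', y'⟩ hx' hxx
    simp only [Finset.coe_filter, Set.mem_ofPred_eq] at hx hx' hxx
    rw [Prod.mk.injEq]
    exact ⟨hxx, hx.2.trans hx'.2.symm⟩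
  have hcard : ∀ W : Finset (G × H), W.image Prod.snd ⊆ Z.image Prod.snd →
      (W.card : ℝ) = ∑ h ∈ Z.image Prod.snd, ((F W h).card : ℝ) := by
    intro W hW
    have := Finset.card_eq_sum_card_fiberwise (f := Prod.snd) (s := W) (t := Z.image Prod.snd)
      fun z hz => hW (Finset.mem_image_of_mem _ hz)
    rw [this]
    push_cast
    exact Finset.sum_congr rfl fun h _ => by rw [hFcard]
  rw [hcard Z subset_rfl, hcard (Z + S ×ˢ ({0} : Finset H)), Finset.mul_sum]
  · refine Finset.sum_le_sum fun h _ => ?_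
    have h1 : F Z h ⊆ A := by
      intro x hx
      obtain ⟨z, hz, rfl⟩ := Finset.mem_image.1 hx
      exact hZ z (Finset.mem_filter.1 hz).1
    refine (hD _ h1).trans ?_
    norm_cast
    refine Finset.card_le_card ?_
    intro y hy
    obtain ⟨x, hx, s, hs, rfl⟩ := Finset.mem_add.1 hy
    obtain ⟨z, hz, rfl⟩ := Finset.mem_image.1 hx
    rw [Finset.mem_filter] at hz
    refine Finset.mem_image.2 ⟨z + (s, 0), Finset.mem_filter.2 ⟨Finset.add_mem_add hz.1 ?_, ?_⟩, rfl⟩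
    · simp [hs]
    · simp [hz.2]
  · intro h hh
    obtain ⟨y, hy, rfl⟩ := Finset.mem_image.1 hh
    obtain ⟨z, hz, s, hs, rfl⟩ := Finset.mem_add.1 hy
    rw [Finset.mem_product, Finset.mem_singleton] at hs
    refine Finset.mem_image.2 ⟨z, hz, ?_⟩
    rw [Prod.snd_add, hs.2, add_zero]

/-- Since S × S = S × {0} + {0} × S, the coordinates grow one after the other, with a swap in
between. -/
theorem magnification_product_self {A S : Finset G} {D : ℝ} (hD0 : 0 ≤ D)
    (hD : ∀ X ⊆ A, D * X.card ≤ ((X + S).card : ℝ)) (Z : Finset (G × G)) (hZ : Z ⊆ A ×ˢ A) :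
    D ^ 2 * Z.card ≤ ((Z + S ×ˢ S).card : ℝ) := by
  have hswap : ∀ W : Finset (G × G), (W.image Prod.swap).card = W.card := fun W =>
    Finset.card_image_of_injective _ Prod.swap_injective
  have h1 := magnification_fst hD Z fun z hz => (Finset.mem_product.1 (hZ hz)).1
  have h2 := magnification_fst hD ((Z + S ×ˢ ({0} : Finset G)).image Prod.swap) ?_
  · rw [hswap] at h2
    have h3 : ((Z + S ×ˢ ({0} : Finset G)).image Prod.swap + S ×ˢ ({0} : Finset G)).card =
        (Z + S ×ˢ S).card := by
      rw [← hswap (Z + S ×ˢ S)]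
      congr 1
      ext ⟨x, y⟩
      simp only [Finset.mem_add, Finset.mem_image, Finset.mem_product, Finset.mem_singleton,
        Prod.exists, Prod.swap_prod_mk, Prod.mk.injEq, Prod.mk_add_mk]
      constructor
      · rintro ⟨_, _, ⟨_, _, ⟨a, b, hab, s, _, ⟨hs, rfl⟩, rfl, rfl⟩, rfl, rfl⟩, t, _, ⟨ht, rfl⟩,
          rfl, rfl⟩
        exact ⟨a + s, b + t, ⟨a, b, hab, s, t, ⟨hs, ht⟩, rfl, rfl⟩, by simp, by simp⟩
      · rintro ⟨_, _, ⟨a, b, hab, s, t, ⟨hs, ht⟩, rfl, rfl⟩, rfl, rfl⟩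
        exact ⟨b, a + s, ⟨a + s, b, ⟨a, b, hab, s, 0, ⟨hs, rfl⟩, rfl, by simp⟩, rfl, rfl⟩, t, 0,
          ⟨ht, rfl⟩, rfl, by simp⟩
    rw [h3] at h2
    calc D ^ 2 * Z.card = D * (D * Z.card) := by ring
      _ ≤ _ := (mul_le_mul_of_nonneg_left h1 hD0).trans h2
  · intro z hz
    obtain ⟨y, hy, rfl⟩ := Finset.mem_image.1 hz
    obtain ⟨w, hw, s, hs, rfl⟩ := Finset.mem_add.1 hy
    rw [Finset.mem_product, Finset.mem_singleton] at hs
    rw [Prod.fst_swap, Prod.snd_add, hs.2, add_zero]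
    exact (Finset.mem_product.1 (hZ hw)).2

end Tensor

/-- Plünnecke's inequality for different summands. -/
theorem exists_nonempty_card_add_le.{u, v} {ι : Type v} [DecidableEq ι] {G : Type u}
    [AddCommGroup G] [DecidableEq G] {A : Finset G} (B : ι → Finset G) {K : Finset ι} {k l : ℕ}
    (hl : 1 ≤ l) (hlk : l ≤ k) (hK : K.card = k) (hA : A.Nonempty) :
    ∃ X ⊆ A, X.Nonempty ∧ ((X + ∑ i ∈ K, B i).card : ℝ) ≤
      (∏ L ∈ K.powersetCard l, ratio A B L ^ expo k l) * X.card := by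
  obtain ⟨d, rfl⟩ := Nat.exists_eq_add_of_le hlk
  -- `C` is fixed before the group, so it serves every power of G and enters only once beside the
  -- 2^n-th powers.
  obtain ⟨C, hC, h⟩ := exists_const_card_add_le.{u, v} (ι := ι) d l hl
  have hC0 : 0 < C := by linarith
  have key : ∀ n : ℕ, ∀ (G : Type u) [AddCommGroup G] [DecidableEq G] (A : Finset G)
      (B : ι → Finset G) (D : ℝ), 0 ≤ D → A.Nonempty →
      (∀ X ⊆ A, D * X.card ≤ ((X + ∑ i ∈ K, B i).card : ℝ)) →
      D ^ 2 ^ n ≤ C * (∏ L ∈ K.powersetCard l, ratio A B L ^ expo (l + d) l) ^ 2 ^ n := by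
    intro n
    induction n with
    | zero =>
      intro G _ _ A B D _ hA hD
      obtain ⟨X, hXA, hX, hXc⟩ := h G A B K hK hA
      have h0 : (0 : ℝ) < X.card := by exact_mod_cast hX.card_pos
      rw [pow_zero, pow_one, pow_one]
      exact le_of_mul_le_mul_right ((hD X hXA).trans hXc) h0
    | succ n ih =>
      intro G _ _ A B D hD0 hA hD
      have := ih (G × G) (A ×ˢ A) (fun i => B i ×ˢ B i) (D ^ 2) (by positivity) (hA.product hA) ?_
      · rw [pow_succ', pow_mul, pow_mul]
        refine this.trans_eq ?_
        rw [← Finset.prod_pow _ 2]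
        congr 2
        refine Finset.prod_congr rfl fun L _ => ?_
        rw [ratio_product_self, Real.rpow_pow_comm (ratio_nonneg _ _ _)]
      · intro Z hZ
        rw [sum_product_self]
        exact magnification_product_self hD0 hD Z hZ
  obtain ⟨X, hXA, hX, hmin⟩ := exists_min_ratio hA (∑ i ∈ K, B i)
  have h0 : (0 : ℝ) < X.card := by exact_mod_cast hX.card_pos
  refine ⟨X, hXA, hX, ?_⟩
  rw [← div_le_iff₀ h0]
  set D : ℝ := ((X + ∑ i ∈ K, B i).card : ℝ) / X.card with hD
  set β : ℝ := ∏ L ∈ K.powersetCard l, ratio A B L ^ expo (l + d) l with hβ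
  have hD0 : 0 ≤ D := by positivity
  have hβ0 : 0 ≤ β := Finset.prod_nonneg fun L _ => Real.rpow_nonneg (ratio_nonneg _ _ _) _
  have hkey : ∀ n : ℕ, D ^ 2 ^ n ≤ C * β ^ 2 ^ n := fun n => key n G A B D hD0 hA hmin
  by_contra hlt
  rw [not_le] at hlt
  rcases hβ0.eq_or_lt with hb | hb
  · have := hkey 0
    rw [← hb] at this hlt
    simp at this
    linarith
  · have h1 : 1 < D / β := (one_lt_div hb).2 hlt
    obtain ⟨n, hn⟩ := pow_unbounded_of_one_lt C h1
    have h2 : (D / β) ^ n ≤ (D / β) ^ 2 ^ n := pow_le_pow_right₀ h1.le Nat.lt_two_pow_self.le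
    have h3 := hkey n
    have hbp : 0 < β ^ 2 ^ n := pow_pos hb _
    have h4 : (D / β) ^ 2 ^ n ≤ C := by
      rw [div_pow]
      exact (div_le_iff₀ hbp).2 h3
    linarith

end DifferentSummands

namespace DifferentSummands

/-! ### Large subsets by greedy union -/

theorem exists_nonempty_card_add_le_beta {G : Type*} [AddCommGroup G] [DecidableEq G] {k l : ℕ}
    (hl : 1 ≤ l) (hlk : l < k) {A A' : Finset G} (B : Fin k → Finset G) (hA' : A' ⊆ A)
    (hne : A'.Nonempty) :
    ∃ X ⊆ A', X.Nonempty ∧ ((X + sumset B Finset.univ).card : ℝ) ≤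
      beta l A B * (A.card : ℝ) ^ ((k : ℝ) / l) * (A'.card : ℝ) ^ (-((k : ℝ) / l)) * X.card := by
  have h0 : (0 : ℝ) < A'.card := by exact_mod_cast hne.card_pos
  have h1 : (0 : ℝ) < A.card := by exact_mod_cast (hne.mono hA').card_pos
  have hK : (Finset.univ : Finset (Fin k)).card = k := by simp
  obtain ⟨X, hX, hXne, hXc⟩ := exists_nonempty_card_add_le B hl hlk.le hK hne
  refine ⟨X, hX, hXne, hXc.trans (mul_le_mul_of_nonneg_right ?_ (Nat.cast_nonneg _))⟩
  have hq : 0 ≤ (A.card : ℝ) / A'.card := by positivity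
  calc ∏ L ∈ (Finset.univ : Finset (Fin k)).powersetCard l, ratio A' B L ^ expo k l
      ≤ ∏ L ∈ (Finset.univ : Finset (Fin k)).powersetCard l,
          ((A.card : ℝ) / A'.card * ratio A B L) ^ expo k l := by
        refine Finset.prod_le_prod (fun L _ => Real.rpow_nonneg (ratio_nonneg _ _ _) _) fun L _ => ?_
        refine Real.rpow_le_rpow (ratio_nonneg _ _ _) ?_ (expo_nonneg _ _)
        exact ratio_le_mul_of_subset B L hA' hne (by field_simp; exact le_rfl)
    _ = (((A.card : ℝ) / A'.card) ^ expo k l) ^ k.choose l *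
          ∏ L ∈ (Finset.univ : Finset (Fin k)).powersetCard l, ratio A B L ^ expo k l := by
        rw [Finset.prod_congr rfl fun L _ => Real.mul_rpow hq (ratio_nonneg A B L),
          Finset.prod_mul_distrib, Finset.prod_const, Finset.card_powersetCard, hK]
    _ = ((A.card : ℝ) ^ ((k : ℝ) / l) * (A'.card : ℝ) ^ (-((k : ℝ) / l))) * beta l A B := by
        congr 1
        · rw [← Real.rpow_natCast, ← Real.rpow_mul hq, expo_mul_choose hl hlk.le,
            Real.div_rpow h1.le h0.le, Real.rpow_neg h0.le, div_eq_mul_inv]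
        · exact Real.finsetProd_rpow _ _ (fun L _ => ratio_nonneg A B L) _
    _ = _ := by ring

theorem beta_nonneg {G : Type*} [AddCommGroup G] [DecidableEq G] {k : ℕ} (l : ℕ) (A : Finset G)
    (B : Fin k → Finset G) : 0 ≤ beta l A B :=
  Real.rpow_nonneg (Finset.prod_nonneg fun L _ => ratio_nonneg A B L) _

/-- If every nonempty `A' ⊆ A` contains a nonempty `X` with `|X + S| ≤ c |A'| ^ (-γ) |X|`, then
subsets of any prescribed size can be built greedily. -/
theorem exists_large_card_add_le_sum {G : Type*} [AddCommGroup G] [DecidableEq G] {A S : Finset G}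
    {c γ : ℝ} (hc : 0 ≤ c) (hγ : 0 ≤ γ)
    (h : ∀ A' ⊆ A, A'.Nonempty → ∃ X ⊆ A', X.Nonempty ∧
      ((X + S).card : ℝ) ≤ c * (A'.card : ℝ) ^ (-γ) * X.card) (a : ℕ) (ha : a ≤ A.card) :
    ∃ X ⊆ A, a ≤ X.card ∧ ((X + S).card : ℝ) ≤
      c * ((∑ j ∈ Finset.range a, ((A.card : ℝ) - j) ^ (-γ)) +
        ((X.card : ℝ) - a) * ((A.card : ℝ) - a + 1) ^ (-γ)) := by
  induction a with
  | zero => exact ⟨∅, by simp⟩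
  | succ a ih =>
    obtain ⟨X, hXA, haX, hX⟩ := ih (by omega)
    have ham : (a : ℝ) + 1 ≤ A.card := by exact_mod_cast ha
    have hsub : (A.card : ℝ) - ((a + 1 : ℕ) : ℝ) + 1 = A.card - a := by push_cast; ring
    rcases haX.eq_or_lt with heq | hlt
    -- Here |X| = a, and a further piece is taken from the m - a remaining elements.
    · have hcard : (A \ X).card = A.card - a := by rw [Finset.card_sdiff_of_subset hXA, heq]
      have hcard' : ((A \ X).card : ℝ) = A.card - a := by
        rw [hcard, Nat.cast_sub (by omega)]
      obtain ⟨Y, hY, hYne, hYc⟩ := h (A \ X) Finset.sdiff_subset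
        (Finset.card_pos.1 (by rw [hcard]; omega))
      have hdisj : Disjoint X Y := Finset.disjoint_of_subset_right hY Finset.disjoint_sdiff
      have hYpos := hYne.card_pos
      refine ⟨X ∪ Y, Finset.union_subset hXA (hY.trans Finset.sdiff_subset), ?_, ?_⟩
      · rw [Finset.card_union_of_disjoint hdisj]; omega
      · have h1 : (((X + S) ∪ (Y + S)).card : ℝ) ≤ (X + S).card + (Y + S).card := by
          exact_mod_cast Finset.card_union_le _ _
        rw [hcard'] at hYc
        rw [Finset.union_add, Finset.card_union_of_disjoint hdisj, Finset.sum_range_succ, hsub,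
          ← heq]
        rw [← heq] at hX
        push_cast
        refine h1.trans ((add_le_add hX hYc).trans_eq ?_)
        ring
    -- `X` already has more than a elements and is kept; a larger factor for the |X| - a surplus
    -- elements only weakens the bound.
    · refine ⟨X, hXA, hlt, hX.trans (mul_le_mul_of_nonneg_left ?_ hc)⟩
      rw [Finset.sum_range_succ, hsub]
      have h1 : ((A.card : ℝ) - a + 1) ^ (-γ) ≤ ((A.card : ℝ) - a) ^ (-γ) :=
        Real.rpow_le_rpow_of_nonpos (by linarith) (by linarith) (by linarith)
      have h2 : (0 : ℝ) ≤ (X.card : ℝ) - a := sub_nonneg.2 (by exact_mod_cast haX)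
      have h3 := mul_le_mul_of_nonneg_left h1 h2
      push_cast
      linarith

/-! ### Comparison of sum and integral -/

/-- The right side is the integral of the decreasing function s^(-γ) over [v, u]. By homogeneity
this is a Bernoulli inequality for v/u. -/
theorem sub_mul_rpow_neg_le {γ u v : ℝ} (hγ : 1 < γ) (hv : 0 < v) (hvu : v ≤ u) :
    (u - v) * u ^ (-γ) ≤ 1 / (γ - 1) * (v ^ (1 - γ) - u ^ (1 - γ)) := by
  have hu : 0 < u := hv.trans_le hvu
  have hr : 0 < v / u := by positivity
  have h1 : 1 + (γ - 1) * (1 - v / u) ≤ (v / u) ^ (1 - γ) := by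
    rw [Real.rpow_def_of_pos hr]
    have h2 := Real.add_one_le_exp (Real.log (v / u) * (1 - γ))
    have h3 := mul_le_mul_of_nonneg_left (Real.log_le_sub_one_of_pos hr) (sub_nonneg.2 hγ.le)
    linarith
  have h2 : v ^ (1 - γ) = (v / u) ^ (1 - γ) * u ^ (1 - γ) := by
    rw [Real.div_rpow hv.le hu.le, div_mul_cancel₀ _ (Real.rpow_pos_of_pos hu _).ne']
  have h3 : u ^ (1 - γ) = u * u ^ (-γ) := by
    rw [sub_eq_add_neg, Real.rpow_add hu, Real.rpow_one]
  have hupos : 0 < u ^ (1 - γ) := Real.rpow_pos_of_pos hu _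
  have hγ' : 0 < γ - 1 := sub_pos.2 hγ
  have h4 : (u - v) * u ^ (-γ) = (1 - v / u) * u ^ (1 - γ) := by
    rw [h3]; field_simp
  rw [h4, one_div, inv_mul_eq_div, le_div_iff₀ hγ', h2]
  have := mul_le_mul_of_nonneg_right h1 hupos.le
  linarith

/-- Comparison of the sum with the corresponding integral, evaluated in closed form. -/
theorem sum_rpow_neg_le {γ m t x : ℝ} {n : ℕ} (hγ : 1 < γ) (hnt : (n : ℝ) ≤ t) (htm : t < m)
    (htx : t ≤ x) :
    (∑ j ∈ Finset.range (n + 1), (m - j) ^ (-γ)) + (x - (n + 1 : ℕ)) * (m - (n + 1 : ℕ) + 1) ^ (-γ) ≤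
      1 / (γ - 1) * ((m - t) ^ (1 - γ) - m ^ (1 - γ)) + (x - t) * (m - t) ^ (-γ) := by
  have hsum : ∀ n : ℕ, (n : ℝ) < m → ∑ j ∈ Finset.range n, (m - j) ^ (-γ) ≤
      1 / (γ - 1) * ((m - n) ^ (1 - γ) - m ^ (1 - γ)) := by
    intro n
    induction n with
    | zero => intro _; simp
    | succ n ih =>
      intro hn
      push_cast at hn
      have h1 := ih (by linarith)
      have h2 := sub_mul_rpow_neg_le (u := m - n) (v := m - (n + 1)) hγ (by linarith) (by linarith)
      rw [show m - (n : ℝ) - (m - (n + 1)) = 1 by ring, one_mul] at h2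
      rw [Finset.sum_range_succ]
      push_cast
      linarith
  have h1 := hsum n (by linarith)
  -- The coefficient x - n of the last power splits as (t - n) + (x - t), and the first part
  -- completes the integral up to t.
  have h2 := sub_mul_rpow_neg_le (u := m - n) (v := m - t) hγ (by linarith) (by linarith)
  have h3 : (m - n) ^ (-γ) ≤ (m - t) ^ (-γ) :=
    Real.rpow_le_rpow_of_nonpos (by linarith) (by linarith) (by linarith)
  have h4 := mul_le_mul_of_nonneg_left h3 (sub_nonneg.2 htx)
  have h5 : m - ((n + 1 : ℕ) : ℝ) + 1 = m - n := by push_cast; ring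
  rw [Finset.sum_range_succ, h5]
  push_cast
  linarith

end DifferentSummands

theorem mainTheorem3 {G : Type*} [AddCommGroup G] [DecidableEq G] (k l : ℕ)
    (hl : 1 ≤ l) (hlk : l < k) (A : Finset G) (B : Fin k → Finset G) (m : ℕ)
    (hm : A.card = m) :
    (∀ a : ℕ, 1 ≤ a → a ≤ m →
      ∃ X : Finset G, X ⊆ A ∧ a ≤ X.card ∧
        ((X + DifferentSummands.sumset B Finset.univ).card : ℝ) ≤
          DifferentSummands.beta l A B * (m : ℝ) ^ ((k : ℝ) / (l : ℝ)) *
            ((∑ j ∈ Finset.range a, ((m : ℝ) - (j : ℝ)) ^ (-((k : ℝ) / (l : ℝ)))) +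
              ((X.card : ℝ) - (a : ℝ)) * ((m : ℝ) - (a : ℝ) + 1) ^ (-((k : ℝ) / (l : ℝ))))) ∧
    (∀ t : ℝ, 0 ≤ t → t < (m : ℝ) →
      ∃ X : Finset G, X ⊆ A ∧ t < (X.card : ℝ) ∧
        ((X + DifferentSummands.sumset B Finset.univ).card : ℝ) ≤
          DifferentSummands.beta l A B * (m : ℝ) ^ ((k : ℝ) / (l : ℝ)) *
            ((l : ℝ) / ((k : ℝ) - (l : ℝ)) *
                (((m : ℝ) - t) ^ (1 - (k : ℝ) / (l : ℝ)) - (m : ℝ) ^ (1 - (k : ℝ) / (l : ℝ))) +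
              ((X.card : ℝ) - t) * ((m : ℝ) - t) ^ (-((k : ℝ) / (l : ℝ))))) := by
  subst hm
  have hl0 : (0 : ℝ) < l := by exact_mod_cast hl
  have hlk' : (l : ℝ) < k := by exact_mod_cast hlk
  have hγ : 1 < (k : ℝ) / l := (one_lt_div hl0).2 hlk'
  have hc : 0 ≤ DifferentSummands.beta l A B * (A.card : ℝ) ^ ((k : ℝ) / (l : ℝ)) :=
    mul_nonneg (DifferentSummands.beta_nonneg l A B) (by positivity)
  have key := DifferentSummands.exists_large_card_add_le_sum hc (by linarith)
    fun A' hA' hne => DifferentSummands.exists_nonempty_card_add_le_beta hl hlk B hA' hne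
  refine ⟨fun a _ ha => key a ha, fun t ht htm => ?_⟩
  -- For an integer |X|, exceeding t means being at least ⌊t⌋ + 1.
  obtain ⟨X, hXA, hX, hXc⟩ := key (⌊t⌋₊ + 1) ((Nat.floor_lt ht).2 htm)
  have htX : t < X.card := (Nat.floor_lt ht).1 hX
  refine ⟨X, hXA, htX, hXc.trans (mul_le_mul_of_nonneg_left ?_ hc)⟩
  have hcoef : (l : ℝ) / ((k : ℝ) - l) = 1 / ((k : ℝ) / l - 1) := by
    rw [div_sub_one hl0.ne', one_div_div]
  rw [hcoef]
  exact DifferentSummands.sum_rpow_neg_le hγ (Nat.floor_le ht) htm htX.le
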